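/- Consider a liquid storage system with $n$ nodes, every node storing one fragment of every object, and $0\le r<n$ repair fragments. The nodes fail independently, node $i$ at the points of a Poisson process of rate $\lambda>0$, and a failed node is immediately replaced by an empty one. A continuum of objects sits in a repair queue with relative positions in $[0,1)$; objects advance at the constant rate $1/T$, where $T>0$ is the time needed to repair all objects once. When an object reaches the head (position $1$) all its missing fragments are restored and it reenters at the tail (position $0$). So the fragments that an object is missing at time $t$ are those of the nodes that have failed since the last repair of this object, or since time $0$ if it has not yet been repaired; at time $0$ no object is missing a fragment. Let $\mathrm{MTTDL}\in[0,\infty]$ be the expected value of the first time at which some object is missing at least $r+1$ fragments. Put $$q(s)=\binom{n}{s}\,e^{-\lambda T(n-s)}\,(1-e^{-\lambda T})^{s}\quad(0\le s\le n),\qquad q(>r)=\sum_{s=r+1}^{n}q(s).$$ Then $$\mathrm{MTTDL}\;\ge\;\frac{1}{\lambda\,(n-r)\,q(r)}-\frac{T}{1-q(>r)}.$$ -/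

import Mathlib

open MeasureTheory ProbabilityTheory
open scoped NNReal ENNReal

noncomputable section

namespace LiquidSystem

/-- `N t ω` is the number of points in `(0, t]` of a homogeneous Poisson process of rate `lam`. -/
structure IsPoissonProcess {Ω : Type*} [MeasurableSpace Ω] (μ : Measure Ω) (lam : ℝ≥0)
    (N : ℝ≥0 → Ω → ℕ) : Prop where
  measurable : ∀ t, Measurable (N t)
  start_zero : ∀ᵐ ω ∂μ, N 0 ω = 0
  mono : ∀ᵐ ω ∂μ, Monotone fun t => N t ω
  right_cts : ∀ᵐ ω ∂μ, ∀ t, ContinuousWithinAt (fun s => N s ω) (Set.Ici t) t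
  indep_increments : HasIndepIncrements N μ
  law_increments : ∀ s t : ℝ≥0, s ≤ t →
    HasLaw (fun ω => N t ω - N s ω) (poissonMeasure (lam * (t - s))) μ

/-- The `n` nodes fail independently of each other, each one at the points of a Poisson process
of rate `lam`; `N i t` is the number of failures of node `i` during `(0, t]`. A failed node is
replaced at once by an empty one, so that it can fail again. -/
structure IsFailureProcess {Ω : Type*} [MeasurableSpace Ω] (μ : Measure Ω) (n : ℕ) (lam : ℝ≥0)
    (N : Fin n → ℝ≥0 → Ω → ℕ) : Prop where
  poisson : ∀ i, IsPoissonProcess μ lam (N i)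
  indep : iIndepFun (fun (i : Fin n) (ω : Ω) (t : ℝ≥0) => N i t ω) μ

/-- The relative position in the repair queue at time `t` of the object that was at the relative
position `u ∈ [0, 1)` at time `0`. Position `0` is the tail, where an object that has just been
repaired enters; objects advance at the constant speed `1 / T`, are repaired on reaching
position `1`, and reenter at the tail. -/
def position (T u : ℝ) (t : ℝ≥0) : ℝ := Int.fract (u + t / T)

/-- The time at which an object was last repaired; it is `0` (the time of the perfect initial
state) if the object has not yet been repaired: `Real.toNNReal` is truncation at `0`. -/
def lastRepair (T u : ℝ) (t : ℝ≥0) : ℝ≥0 := Real.toNNReal (t - T * position T u t)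

/-- The number of missing fragments at time `t` of the object with initial position `u`, every node
storing one fragment of every object: the number of nodes that have failed since the last repair of
the object, all fragments being present at time `0`. -/
def missing {Ω : Type*} {n : ℕ} (N : Fin n → ℝ≥0 → Ω → ℕ) (T u : ℝ) (t : ℝ≥0) (ω : Ω) : ℕ :=
  (Finset.univ.filter fun i : Fin n => N i (lastRepair T u t) ω < N i t ω).card

/-- The first time at which some object has at least `r + 1` missing fragments (`∞` if there is no
such time). -/
def dataLossTime {Ω : Type*} {n : ℕ} (N : Fin n → ℝ≥0 → Ω → ℕ) (r : ℕ) (T : ℝ) (ω : Ω) : ℝ≥0∞ :=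
  ⨅ (t : ℝ≥0) (_ : ∃ u ∈ Set.Ico (0 : ℝ) 1, r + 1 ≤ missing N T u t ω), (t : ℝ≥0∞)

/-- The mean time to data loss, from a perfect initial queue. -/
def MTTDL {Ω : Type*} [MeasurableSpace Ω] (μ : Measure Ω) {n : ℕ} (N : Fin n → ℝ≥0 → Ω → ℕ)
    (r : ℕ) (T : ℝ) : ℝ≥0∞ :=
  ∫⁻ ω, dataLossTime N r T ω ∂μ

/-- `B(n, m, p) = (n choose m) p ^ (n - m) (1 - p) ^ m`. -/
def B (n m : ℕ) (p : ℝ) : ℝ := (n.choose m : ℝ) * p ^ (n - m) * (1 - p) ^ m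

/-- `q(s)`, the steady-state probability that the object at the head of the queue has `s` missing
fragments. -/
def q (n : ℕ) (lam T : ℝ) (s : ℕ) : ℝ := B n s (Real.exp (-(lam * T)))

/-- `q(> r)`, the sum of `q(s)` over `s > r`. -/
def qGt (n : ℕ) (lam T : ℝ) (r : ℕ) : ℝ := ∑ s ∈ Finset.Ioc r n, q n lam T s

end LiquidSystem

end

/-! Cut time into cells of length `δ = T / m` and watch the number of nodes that fail in a sliding
window of `m + 1` cells. By stationarity, this number passes from at most `r` to more than `r` at
each step with one fixed probability `u`, roughly `δ` times `λ (n - r) q(r)`: `r` nodes are already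
hit and one of the other `n - r` fails in the new cell. So bounding the mean gap between such
upcrossings by the survival time of a perfect system bounds the latter from below.

Splitting a horizon of `X` cells at its last upcrossing gives `1 ≤ P (quiet X) + u * ∑ k < X, P
(quiet k)` (`one_le_real_quiet_add`). The event `quiet` allows any past, so it is independent of the
upcrossing before it. A quiet stretch either starts with a good window (at most `r` nodes hit,
probability `g`), after which even a perfect system must survive, or it is quiet again one window
later. Summing, `∑ P (quiet k) ≤ (m + 1) / g + ∑ P (survives k)` (`mul_sum_real_quiet_le`), and the
last sum is at most `1 + MTTDL / δ` (`sum_real_survives_le`).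

Hence `1 ≤ u * ((m + 1) / g + 1 + MTTDL / δ)`; as `δ → 0` this becomes `1 ≤ λ (n - r) q(r) * (T / (1
- q(>r)) + MTTDL)`. -/

namespace LiquidSystem

/-! ### Sliding windows and upcrossings of a fixed failure pattern. -/

/-- Failure patterns in discrete time: `x k i` says whether node `i` fails in the time cell `k`. -/
abbrev Cells (n : ℕ) : Type := ℕ → Fin n → Bool

variable {n : ℕ}

/-- The pattern seen from cell `s` on. -/
def shift (s : ℕ) (x : Cells n) : Cells n := fun k => x (k + s)

/-- The nodes that fail in one of the cells `a, …, b - 1`. -/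
def hits (x : Cells n) (a b : ℕ) : Finset (Fin n) :=
  Finset.univ.filter fun i => ∃ k ∈ Finset.Ico a b, x k i = true

lemma mem_hits {x : Cells n} {a b : ℕ} {i : Fin n} :
    i ∈ hits x a b ↔ ∃ k, a ≤ k ∧ k < b ∧ x k i = true := by
  simp [hits, and_assoc]

lemma hits_shift (s : ℕ) (x : Cells n) (a b : ℕ) :
    hits (shift s x) a b = hits x (a + s) (b + s) := by
  ext i
  simp only [mem_hits, shift]
  constructor
  · rintro ⟨k, h1, h2, h3⟩
    exact ⟨k + s, by omega, by omega, h3⟩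
  · rintro ⟨k, h1, h2, h3⟩
    refine ⟨k - s, by omega, by omega, ?_⟩
    rwa [Nat.sub_add_cancel (by omega)]

lemma hits_mono (x : Cells n) {a a' b b' : ℕ} (ha : a' ≤ a) (hb : b ≤ b') :
    hits x a b ⊆ hits x a' b' := by
  intro i
  simp only [mem_hits]
  rintro ⟨k, h1, h2, h3⟩
  exact ⟨k, by omega, by omega, h3⟩

lemma hits_congr {x y : Cells n} {a b : ℕ} (h : ∀ k < b, x k = y k) : hits x a b = hits y a b := by
  ext i
  simp only [mem_hits]
  refine exists_congr fun k => and_congr_right fun _ => and_congr_right fun hk => ?_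
  rw [h k hk]

lemma shift_shift (s t : ℕ) (x : Cells n) : shift s (shift t x) = shift (s + t) x := by
  funext k
  simp [shift, add_assoc]

/-- Starting from an empty window at cell `0`, no window of `m + 1` cells that ends
before cell `c` contains failures of more than `r` nodes. -/
def survives (r m c : ℕ) : Set (Cells n) := {x | ∀ k < c, (hits x (k - m) (k + 1)).card ≤ r}

/-- When the window of `m + 1` cells is moved from cell `k` to cell `k + 1`, the number of
nodes failing in it goes from at most `r` to more than `r`. -/
def upcross (r m k : ℕ) : Set (Cells n) :=
  {x | (hits x k (k + m + 1)).card ≤ r ∧ r < (hits x (k + 1) (k + m + 2)).card}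

/-- With a suitable pattern in the `m + 1` cells before cell `0`, there is no upcrossing before
cell `c`. -/
def quiet (r m c : ℕ) : Set (Cells n) :=
  {x | ∃ y, shift (m + 1) y = x ∧ ∀ k < c, y ∉ upcross r m k}

/-- Membership in `B` depends on the first `c` cells only. -/
def Determined (c : ℕ) (B : Set (Cells n)) : Prop :=
  ∀ x y, (∀ k < c, x k = y k) → x ∈ B → y ∈ B

lemma shift_mem_upcross {r m k s : ℕ} {x : Cells n} :
    shift s x ∈ upcross r m k ↔ x ∈ upcross r m (k + s) := by
  simp only [upcross, Set.mem_ofPred_eq, hits_shift]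
  rw [show k + m + 1 + s = k + s + m + 1 by ring, show k + 1 + s = k + s + 1 by ring,
    show k + m + 2 + s = k + s + m + 2 by ring]

lemma determined_survives (r m c : ℕ) : Determined c (survives (n := n) r m c) := by
  intro x y h hx k hk
  rw [← hits_congr fun j hj => h j (by omega)]
  exact hx k hk

lemma determined_card_hits_le (r a b : ℕ) : Determined b {x : Cells n | (hits x a b).card ≤ r} := by
  intro x y h hx
  rw [Set.mem_ofPred_eq, ← hits_congr h]
  exact hx

lemma determined_upcross (r m k : ℕ) : Determined (k + m + 2) (upcross (n := n) r m k) := by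
  intro x y h hx
  rw [upcross, Set.mem_ofPred_eq, ← hits_congr fun j hj => h j (by omega),
    ← hits_congr (a := k + 1) fun j hj => h j (by omega)]
  exact hx

/-- The existential past is what makes this event forget everything before cell `0`: keep the `m +
1` past cells of the witness and glue the new pattern behind them. An upcrossing before `c` reads
only the first `c + m + 1` cells of the glued pattern. -/
lemma determined_quiet (r m c : ℕ) : Determined c (quiet (n := n) r m c) := by
  rintro x y h ⟨z, rfl, hz⟩
  refine ⟨fun k => if k < m + 1 then z k else y (k - (m + 1)), ?_, fun k hk hu => hz k hk ?_⟩
  · funext k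
    simp [shift, show ¬ k + (m + 1) ≤ m by omega]
  · refine determined_upcross r m k _ _ (fun j hj => ?_) hu
    by_cases hjm : j < m + 1
    · simp [hjm]
    · simp only [hjm, if_false]
      rw [← h _ (by omega), shift]
      congr 1
      omega

lemma Determined.compl {c : ℕ} {B : Set (Cells n)} (h : Determined c B) : Determined c Bᶜ :=
  fun x y hxy hx hy => hx (h y x (fun k hk => (hxy k hk).symm) hy)

lemma survives_antitone (r m : ℕ) {c d : ℕ} (h : c ≤ d) :
    survives (n := n) r m d ⊆ survives r m c := fun _ hx k hk => hx k (by omega)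

lemma shift_mem_quiet {r m c : ℕ} {x : Cells n} (h : ∀ k < c, x ∉ upcross r m k) :
    shift (m + 1) x ∈ quiet r m c := ⟨x, rfl, h⟩

/-- After one window, a quiet pattern is quiet again. -/
lemma quiet_add_shift_mem_quiet {r m c : ℕ} {x : Cells n} (hx : x ∈ quiet r m (c + (m + 1))) :
    shift (m + 1) x ∈ quiet r m c := by
  obtain ⟨y, rfl, hy⟩ := hx
  refine shift_mem_quiet fun k hk hu => hy (k + (m + 1)) (by omega) (shift_mem_upcross.1 hu)

/-- If the first window of a quiet pattern contains failures of at most `r` nodes, then a system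
that is perfect at the end of this window survives. -/
lemma quiet_add_shift_mem_survives {r m c : ℕ} {x : Cells n} (hx : x ∈ quiet r m (c + (m + 1)))
    (h0 : (hits x 0 (m + 1)).card ≤ r) : shift (m + 1) x ∈ survives r m c := by
  obtain ⟨y, rfl, hy⟩ := hx
  -- Starting at or below `r`, the first window above `r` would be an upcrossing.
  have key : ∀ k ≤ c, (hits (shift (m + 1) y) k (k + m + 1)).card ≤ r := by
    intro k
    induction k with
    | zero => intro _; simpa using h0
    | succ k ih =>
      intro hk
      by_contra! hlt
      refine hy (k + (m + 1)) (by omega) (shift_mem_upcross.1 ⟨ih (by omega), ?_⟩)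
      rwa [show k + m + 2 = k + 1 + m + 1 by ring]
  intro k hk
  -- The perfect system ignores failures before its start, so its truncated window lies inside the
  -- full one.
  refine (Finset.card_le_card ?_).trans (key (k + 1) (by omega))
  rw [hits_shift]
  exact hits_mono _ (by omega) (by omega)

/-- Decomposition according to the last upcrossing. -/
lemma quiet_or_exists_upcross (r m X : ℕ) (x : Cells n) :
    shift (m + 1) x ∈ quiet r m X ∨
      ∃ k ∈ Finset.range X, x ∈ upcross r m k ∧
        shift (k + m + 2) x ∈ quiet r m (X - 1 - k) := by
  by_cases h : ∃ k < X, x ∈ upcross r m k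
  · right
    classical
    set S := (Finset.range X).filter fun k => x ∈ upcross r m k with hS
    have hne : S.Nonempty := by
      obtain ⟨k, hk, hx⟩ := h
      exact ⟨k, by simp [hS, hk, hx]⟩
    have hmem := S.max'_mem hne
    set k := S.max' hne with hk
    rw [hS, Finset.mem_filter] at hmem
    refine ⟨k, hmem.1, hmem.2, ?_⟩
    -- Dropping `k + 1` cells passes the last upcrossing; the next `m + 1` cells serve as the
    -- unknown past.
    rw [show k + m + 2 = (m + 1) + (k + 1) by ring, ← shift_shift]
    refine shift_mem_quiet fun j hj hu => ?_
    have hj' : j + (k + 1) ∈ S := by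
      rw [hS, Finset.mem_filter, Finset.mem_range]
      exact ⟨by omega, shift_mem_upcross.1 hu⟩
    have := S.le_max' _ hj'
    omega
  · left
    push Not at h
    exact shift_mem_quiet h

/-- An upcrossing needs either exactly `r` nodes hit by the common part of the two
windows and a new one in the last cell, or two nodes in the last cell. -/
lemma upcross_zero_subset (r m : ℕ) :
    upcross (n := n) r m 0 ⊆
      (⋃ i : Fin n, {x | (hits x 1 (m + 1)).card = r ∧ i ∉ hits x 1 (m + 1)} ∩
        {x | x (m + 1) i = true}) ∪
      ⋃ p ∈ (Finset.univ : Finset (Fin n)).offDiag,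
        {x : Cells n | x (m + 1) p.1 = true ∧ x (m + 1) p.2 = true} := by
  classical
  rintro x ⟨h1, h2⟩
  simp only [zero_add] at h1 h2
  have hW : (hits x 1 (m + 1)).card ≤ r :=
    (Finset.card_le_card (hits_mono x (by omega) le_rfl)).trans h1
  set N : Finset (Fin n) := Finset.univ.filter fun i => x (m + 1) i = true with hN
  have hsub : hits x 1 (m + 2) ⊆ hits x 1 (m + 1) ∪ (N \ hits x 1 (m + 1)) := by
    intro i hi
    obtain ⟨k, hk1, hk2, hk3⟩ := mem_hits.1 hi
    rw [Finset.mem_union, Finset.mem_sdiff]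
    by_cases hk : k < m + 1
    · exact Or.inl (mem_hits.2 ⟨k, hk1, hk, hk3⟩)
    · obtain rfl : k = m + 1 := by omega
      by_cases hi' : i ∈ hits x 1 (m + 1)
      · exact Or.inl hi'
      · exact Or.inr ⟨by simp [hN, hk3], hi'⟩
  have hcard := (h2.trans_le (Finset.card_le_card hsub)).trans_le (Finset.card_union_le _ _)
  by_cases hr : (hits x 1 (m + 1)).card = r
  · left
    have : (N \ hits x 1 (m + 1)).Nonempty := by
      rw [← Finset.card_pos]; omega
    obtain ⟨i, hi⟩ := this
    rw [Finset.mem_sdiff, hN, Finset.mem_filter] at hi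
    exact Set.mem_iUnion.2 ⟨i, ⟨hr, hi.2⟩, hi.1.2⟩
  · right
    have h2N : 1 < N.card := by
      have := Finset.card_le_card (Finset.sdiff_subset (s := N) (t := hits x 1 (m + 1)))
      omega
    obtain ⟨i, hi, j, hj, hij⟩ := Finset.one_lt_card.1 h2N
    rw [hN, Finset.mem_filter] at hi hj
    exact Set.mem_biUnion (x := (i, j)) (by simp [hij]) ⟨hi.2, hj.2⟩

/-! ### Bernoulli arrays: stationarity, independence and the law of a window. -/

/-- Independent Bernoulli variables with success probability `ε`, indexed by cells and nodes. -/
structure IsBernoulliArray (P : Measure (Cells n)) (ε : ℝ) : Prop where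
  rows : iIndepFun (fun (i : Fin n) (x : Cells n) (k : ℕ) => x k i) P
  cols : ∀ i, iIndepFun (fun (k : ℕ) (x : Cells n) => x k i) P
  prob : ∀ k i, P.real {x | x k i = true} = ε

lemma measurable_entry (k : ℕ) (i : Fin n) : Measurable fun x : Cells n => x k i := by fun_prop

lemma measurable_shift (s : ℕ) : Measurable (shift s : Cells n → Cells n) := by
  unfold shift
  fun_prop

lemma measurable_pi_of_forall {Ω ι : Type*} {X : ι → Type*} [∀ i, MeasurableSpace (X i)]
    {m : MeasurableSpace Ω} {g : Ω → ∀ i, X i} (h : ∀ i, Measurable fun ω => g ω i) :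
    Measurable g := measurable_pi_lambda _ h

/-- Such a set is the preimage of a set under restriction to finitely many Boolean entries, and
every subset of a finite discrete space is measurable. The fine σ-algebra, rather than mere
measurability, is needed for independence of past and future. -/
lemma Determined.measurableSet_iSup {c : ℕ} {B : Set (Cells n)} (hB : Determined c B) :
    MeasurableSet[⨆ p ∈ {p : Fin n × ℕ | p.2 < c},
      MeasurableSpace.comap (fun x : Cells n => x p.2 p.1) inferInstance] B := by
  set g : Cells n → Fin n × Fin c → Bool := fun x p => x p.2 p.1
  have hBg : B = g ⁻¹' (g '' B) := by
    refine Set.Subset.antisymm (Set.subset_preimage_image g B) ?_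
    rintro x ⟨y, hy, hyx⟩
    refine hB y x (fun k hk => ?_) hy
    funext i
    exact congrFun hyx (i, ⟨k, hk⟩)
  rw [hBg]
  have hm : Measurable[⨆ p ∈ {p : Fin n × ℕ | p.2 < c},
      MeasurableSpace.comap (fun x : Cells n => x p.2 p.1) inferInstance] g := by
    refine measurable_pi_of_forall fun p => ?_
    refine Measurable.mono (comap_measurable fun x : Cells n => x p.2 p.1) ?_ le_rfl
    exact le_iSup₂_of_le (p.1, (p.2 : ℕ)) p.2.isLt le_rfl
  exact hm (Set.toFinite _).measurableSet

lemma Determined.measurableSet {c : ℕ} {B : Set (Cells n)} (hB : Determined c B) :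
    MeasurableSet B := by
  refine (iSup₂_le fun p _ => ?_ : (⨆ p ∈ {p : Fin n × ℕ | p.2 < c},
      MeasurableSpace.comap (fun x : Cells n => x p.2 p.1) inferInstance) ≤ _) B
    hB.measurableSet_iSup
  exact (measurable_entry p.2 p.1).comap_le

namespace IsBernoulliArray

variable {P : Measure (Cells n)} {ε : ℝ}

lemma pairs (h : IsBernoulliArray P ε) :
    iIndepFun (fun (p : Fin n × ℕ) (x : Cells n) => x p.2 p.1) P :=
  iIndepFun_uncurry' (X := fun (i : Fin n) (k : ℕ) (x : Cells n) => x k i)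
    (fun i k => measurable_entry k i) h.rows h.cols

lemma map_entry [IsProbabilityMeasure P] (h : IsBernoulliArray P ε) (k l : ℕ) (i : Fin n) :
    P.map (fun x => x k i) = P.map fun x => x l i := by
  have hk : ∀ k, P {x | x k i = true} = ENNReal.ofReal ε := fun k => by
    rw [← h.prob k i, ofReal_measureReal]
  have hk' : ∀ k, P {x | x k i = false} = 1 - ENNReal.ofReal ε := fun k => by
    rw [← hk k, ← prob_compl_eq_one_sub]
    · congr 1
      ext x
      simp
    · exact measurable_entry k i (measurableSet_singleton true)
  refine Measure.ext_of_singleton fun b => ?_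
  rw [Measure.map_apply (measurable_entry _ _) (measurableSet_singleton b),
    Measure.map_apply (measurable_entry _ _) (measurableSet_singleton b)]
  cases b
  · exact (hk' k).trans (hk' l).symm
  · exact (hk k).trans (hk l).symm

/-- Before and after the shift, the entries are independent with the same marginals, so both laws
are the same product measure. -/
lemma map_shift [IsProbabilityMeasure P] (h : IsBernoulliArray P ε) (s : ℕ) :
    P.map (shift s) = P := by
  set φ : Cells n → Fin n × ℕ → Bool := fun x p => x p.2 p.1
  have hφ : Measurable φ := measurable_pi_lambda _ fun p => measurable_entry p.2 p.1
  have h1 := h.pairs.map_fun_eq_infinitePi_map fun p : Fin n × ℕ => measurable_entry p.2 p.1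
  have hinj : Function.Injective fun p : Fin n × ℕ => (p.1, p.2 + s) := by
    rintro ⟨i, k⟩ ⟨j, l⟩ hp
    simpa using hp
  have h2 := iIndepFun.map_fun_eq_infinitePi_map
    (X := fun (p : Fin n × ℕ) (x : Cells n) => x (p.2 + s) p.1)
    (fun p => measurable_entry (p.2 + s) p.1) (h.pairs.precomp hinj)
  have h3 : (P.map (shift s)).map φ = P.map φ := by
    rw [Measure.map_map hφ (measurable_shift s)]
    refine h2.trans (Eq.trans ?_ h1.symm)
    congr 1
    funext p
    exact h.map_entry (p.2 + s) p.2 p.1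
  set ψ : (Fin n × ℕ → Bool) → Cells n := fun y k i => y (i, k)
  have hψ : Measurable ψ := by fun_prop
  have h4 := congrArg (fun Q => Q.map ψ) h3
  simp only [Measure.map_map hψ hφ] at h4
  have hid : ψ ∘ φ = id := rfl
  simpa only [hid, Measure.map_id] using h4

lemma real_shift_preimage [IsProbabilityMeasure P] (h : IsBernoulliArray P ε) (s : ℕ)
    {C : Set (Cells n)} (hC : MeasurableSet C) : P.real (shift s ⁻¹' C) = P.real C := by
  rw [← map_measureReal_apply (measurable_shift s) hC, h.map_shift s]

/-- The first `s` cells are independent of the following ones. -/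
lemma real_inter_shift_preimage [IsProbabilityMeasure P] (h : IsBernoulliArray P ε) {s : ℕ}
    {B C : Set (Cells n)} (hB : Determined s B) (hC : MeasurableSet C) :
    P.real (B ∩ shift s ⁻¹' C) = P.real B * P.real C := by
  have hdisj : Disjoint {p : Fin n × ℕ | p.2 < s} {p : Fin n × ℕ | s ≤ p.2} := by
    rw [Set.disjoint_left]
    intro p (hp : p.2 < s) (hp' : s ≤ p.2)
    omega
  have hind := indep_iSup_of_disjoint
    (fun p : Fin n × ℕ => (measurable_entry p.2 p.1).comap_le) h.pairs hdisj
  have hm : Measurable[⨆ p ∈ {p : Fin n × ℕ | s ≤ p.2},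
      MeasurableSpace.comap (fun x : Cells n => x p.2 p.1) inferInstance] (shift (n := n) s) := by
    refine measurable_pi_of_forall fun k => measurable_pi_of_forall fun i => ?_
    refine Measurable.mono (comap_measurable fun x : Cells n => x (k + s) i) ?_ le_rfl
    exact le_iSup₂_of_le (i, k + s) (Nat.le_add_left s k) le_rfl
  have := (Indep_iff _ _ P).1 hind B (shift s ⁻¹' C) hB.measurableSet_iSup (hm hC)
  rw [← h.real_shift_preimage s hC]
  simp only [measureReal_def, this, ENNReal.toReal_mul]

/-- The probability that node `i` does not fail in a window. -/
lemma real_notMem_hits [IsProbabilityMeasure P] (h : IsBernoulliArray P ε) (a l : ℕ) (i : Fin n) :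
    P.real {x | i ∉ hits x a (a + l)} = (1 - ε) ^ l := by
  have hset : {x : Cells n | i ∉ hits x a (a + l)} =
      ⋂ k ∈ Finset.Ico a (a + l), (fun x : Cells n => x k i) ⁻¹' {false} := by
    ext x
    simp [mem_hits]
  rw [hset, measureReal_def, (h.cols i).measure_inter_preimage_eq_mul _
    (fun k _ => measurableSet_singleton false), ENNReal.toReal_prod]
  have hk : ∀ k, (P ((fun x : Cells n => x k i) ⁻¹' {false})).toReal = 1 - ε := fun k => by
    rw [← h.prob k i, ← probReal_compl_eq_one_sub]
    · rw [measureReal_def]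
      congr 2
      ext x
      simp
    · exact measurable_entry k i (measurableSet_singleton true)
  simp [hk]

lemma measurableSet_hits_eq (a b : ℕ) (S : Finset (Fin n)) :
    MeasurableSet {x : Cells n | hits x a b = S} := by
  refine Determined.measurableSet (c := b) fun x y hxy hx => ?_
  rw [Set.mem_ofPred_eq, ← hits_congr hxy]
  exact hx

lemma real_hits_eq [IsProbabilityMeasure P] (h : IsBernoulliArray P ε) (a l : ℕ)
    (S : Finset (Fin n)) :
    P.real {x | hits x a (a + l) = S} =
      ((1 - ε) ^ l) ^ (n - S.card) * (1 - (1 - ε) ^ l) ^ S.card := by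
  classical
  set F : Set (ℕ → Bool) := {y | ∃ k ∈ Finset.Ico a (a + l), y k = true}
  have hF : MeasurableSet F := by
    have : F = ⋃ k ∈ Finset.Ico a (a + l), (fun y : ℕ → Bool => y k) ⁻¹' {true} := by
      ext y
      simp [F]
    rw [this]
    exact Finset.measurableSet_biUnion _ fun k _ =>
      (measurable_pi_apply k) (measurableSet_singleton true)
  have hmem : ∀ (i : Fin n) (x : Cells n), i ∈ hits x a (a + l) ↔ (fun k => x k i) ∈ F := by
    intro i x
    simp [hits, F]
  have hset : {x : Cells n | hits x a (a + l) = S} = ⋂ i ∈ (Finset.univ : Finset (Fin n)),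
      (fun (x : Cells n) (k : ℕ) => x k i) ⁻¹' (if i ∈ S then F else Fᶜ) := by
    ext x
    simp only [Set.mem_ofPred_eq, Finset.ext_iff, hmem, Set.mem_iInter, Set.mem_preimage,
      Finset.mem_univ, true_implies]
    refine forall_congr' fun i => ?_
    by_cases hi : i ∈ S <;> simp [hi]
  rw [hset, measureReal_def, h.rows.measure_inter_preimage_eq_mul _
    (fun i _ => by split_ifs <;> simp [hF]), ENNReal.toReal_prod]
  have hval : ∀ i, (P ((fun (x : Cells n) (k : ℕ) => x k i) ⁻¹' (if i ∈ S then F else Fᶜ))).toReal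
      = if i ∈ S then 1 - (1 - ε) ^ l else (1 - ε) ^ l := by
    intro i
    have hn := h.real_notMem_hits a l i
    simp only [hmem] at hn
    split_ifs with hi
    · rw [← hn, ← probReal_compl_eq_one_sub]
      · rw [measureReal_def]
        congr 2
        ext x
        simp
      · exact (measurable_pi_lambda _ fun k => measurable_entry k i) hF.compl
    · exact hn
  simp only [hval]
  rw [Finset.prod_ite, Finset.prod_const, Finset.prod_const, mul_comm]
  congr 2
  · rw [Finset.filter_not, Finset.card_sdiff_of_subset (Finset.filter_subset _ _)]
    simp
  · simp

lemma real_card_hits_eq [IsProbabilityMeasure P] (h : IsBernoulliArray P ε) (a l s : ℕ) :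
    P.real {x | (hits x a (a + l)).card = s} = B n s ((1 - ε) ^ l) := by
  have hset : {x : Cells n | (hits x a (a + l)).card = s} =
      ⋃ S ∈ Finset.powersetCard s (Finset.univ : Finset (Fin n)),
        {x | hits x a (a + l) = S} := by
    ext x
    simp [Finset.mem_powersetCard]
  rw [hset, measureReal_biUnion_finset]
  · rw [Finset.sum_congr rfl fun S hS => by
      rw [h.real_hits_eq a l S, (Finset.mem_powersetCard.1 hS).2]]
    rw [Finset.sum_const, Finset.card_powersetCard, Finset.card_univ, Fintype.card_fin, B,
      nsmul_eq_mul, mul_assoc]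
  · intro S _ S' _ hSS'
    rw [Function.onFun, Set.disjoint_left]
    intro x hx hx'
    exact hSS' (hx.symm.trans hx')
  · exact fun S _ => measurableSet_hits_eq _ _ S

lemma real_card_hits_le [IsProbabilityMeasure P] (h : IsBernoulliArray P ε) (a l r : ℕ) :
    P.real {x | (hits x a (a + l)).card ≤ r} =
      1 - ∑ s ∈ Finset.Ioc r n, B n s ((1 - ε) ^ l) := by
  have hset : {x : Cells n | (hits x a (a + l)).card ≤ r}ᶜ =
      ⋃ s ∈ Finset.Ioc r n, {x | (hits x a (a + l)).card = s} := by
    ext x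
    have := (Finset.card_le_univ (hits x a (a + l))).trans_eq (Fintype.card_fin n)
    simp [this]
  have hm : ∀ s, MeasurableSet {x : Cells n | (hits x a (a + l)).card = s} := by
    intro s
    refine Determined.measurableSet (c := a + l) fun x y hxy hx => ?_
    rw [Set.mem_ofPred_eq, ← hits_congr hxy]
    exact hx
  have h1 := probReal_compl_eq_one_sub (μ := P) (determined_card_hits_le (n := n) r a (a + l)).measurableSet
  rw [hset, measureReal_biUnion_finset] at h1
  · rw [Finset.sum_congr rfl fun s _ => h.real_card_hits_eq a l s] at h1
    linarith
  · intro s _ s' _ hs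
    rw [Function.onFun, Set.disjoint_left]
    intro x hx hx'
    exact hs (hx.symm.trans hx')
  · exact fun s _ => hm s

/-- Two different nodes fail in the same cell with probability `ε ^ 2`. -/
lemma real_two_entries (h : IsBernoulliArray P ε) (k : ℕ) {i j : Fin n} (hij : i ≠ j) :
    P.real {x | x k i = true ∧ x k j = true} = ε ^ 2 := by
  have hp : ((i, k) : Fin n × ℕ) ≠ (j, k) := by simpa using hij
  have := (h.pairs.indepFun hp).measure_inter_preimage_eq_mul {true} {true}
    (measurableSet_singleton true) (measurableSet_singleton true)
  have h2 := congrArg ENNReal.toReal this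
  rw [ENNReal.toReal_mul] at h2
  calc _ = _ := h2
    _ = ε * ε := congrArg₂ _ (h.prob k i) (h.prob k j)
    _ = ε ^ 2 := by ring

/-- Double counting: each possible hit set of size `r` is counted once for each of the `n - r` nodes
outside it. -/
lemma sum_real_card_hits_eq_notMem [IsProbabilityMeasure P] (a b r : ℕ) :
    ∑ i : Fin n, P.real {x | (hits x a b).card = r ∧ i ∉ hits x a b} =
      ((n : ℝ) - r) * P.real {x | (hits x a b).card = r} := by
  classical
  have key : ∀ 𝒮 : Finset (Finset (Fin n)),
      P.real {x | hits x a b ∈ 𝒮} = ∑ S ∈ 𝒮, P.real {x | hits x a b = S} := by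
    intro 𝒮
    rw [← measureReal_biUnion_finset]
    · congr 1
      ext x
      simp
    · intro S _ S' _ hSS'
      rw [Function.onFun, Set.disjoint_left]
      intro x hx hx'
      exact hSS' (hx.symm.trans hx')
    · exact fun S _ => measurableSet_hits_eq _ _ S
  have h1 : ∀ i : Fin n, P.real {x | (hits x a b).card = r ∧ i ∉ hits x a b} =
      ∑ S ∈ Finset.powersetCard r Finset.univ,
        if i ∉ S then P.real {x | hits x a b = S} else 0 := by
    intro i
    rw [← Finset.sum_filter, ← key]
    simp [Finset.mem_powersetCard]
  have h2 : P.real {x | (hits x a b).card = r} =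
      ∑ S ∈ Finset.powersetCard r Finset.univ, P.real {x | hits x a b = S} := by
    rw [← key]
    simp [Finset.mem_powersetCard]
  simp only [h1, h2]
  rw [Finset.sum_comm, Finset.mul_sum]
  refine Finset.sum_congr rfl fun S hS => ?_
  have hS' := (Finset.mem_powersetCard.1 hS).2
  have hle := (Finset.card_le_univ S).trans_eq (Fintype.card_fin n)
  have hcard : (Finset.univ.filter fun i => i ∉ S).card = n - r := by
    rw [Finset.filter_not, Finset.card_sdiff_of_subset (Finset.filter_subset _ _)]
    simp [hS']
  rw [← Finset.sum_filter, Finset.sum_const, hcard, nsmul_eq_mul, Nat.cast_sub (by omega)]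

/-! ### The upcrossing probability and the renewal inequality. -/

/-- The probability of an upcrossing in one step. -/
lemma real_upcross_zero_le [IsProbabilityMeasure P] (h : IsBernoulliArray P ε) (r m : ℕ) :
    P.real (upcross r m 0) ≤
      ((n : ℝ) - r) * B n r ((1 - ε) ^ m) * ε + (n : ℝ) ^ 2 * ε ^ 2 := by
  classical
  refine (measureReal_mono (upcross_zero_subset r m)).trans ?_
  refine (measureReal_union_le _ _).trans (add_le_add ?_ ?_)
  · refine (measureReal_iUnion_fintype_le _).trans_eq ?_
    have hi : ∀ i : Fin n, P.real ({x | (hits x 1 (m + 1)).card = r ∧ i ∉ hits x 1 (m + 1)} ∩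
        {x | x (m + 1) i = true}) =
        P.real {x | (hits x 1 (m + 1)).card = r ∧ i ∉ hits x 1 (m + 1)} * ε := by
      intro i
      have hC : {x : Cells n | x (m + 1) i = true} =
          shift (m + 1) ⁻¹' {x | x 0 i = true} := by
        ext x
        simp [shift]
      rw [hC, h.real_inter_shift_preimage, h.prob]
      · intro x y hxy hx
        rw [Set.mem_ofPred_eq, ← hits_congr hxy]
        exact hx
      · exact measurable_entry 0 i (measurableSet_singleton true)
    -- The part common to both windows has `m` cells, not `m + 1`; this will give `q` at exactly `T
    -- = m * δ`.
    rw [Finset.sum_congr rfl fun i _ => hi i, ← Finset.sum_mul, sum_real_card_hits_eq_notMem,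
      add_comm m 1, h.real_card_hits_eq 1 m r]
  · refine (measureReal_biUnion_finset_le _ _).trans ?_
    rw [Finset.sum_congr rfl fun p hp =>
      h.real_two_entries (m + 1) (Finset.mem_offDiag.1 hp).2.2]
    rw [Finset.sum_const, nsmul_eq_mul]
    refine mul_le_mul_of_nonneg_right ?_ (sq_nonneg ε)
    have : (Finset.univ : Finset (Fin n)).offDiag.card ≤ n ^ 2 := by
      rw [Finset.offDiag_card, Finset.card_univ, Fintype.card_fin, sq]
      exact Nat.sub_le _ _
    exact_mod_cast this

/-- The first window is independent of what follows: a good one forces survival afterwards, a bad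
one leaves a quiet pattern. -/
lemma real_quiet_add_le [IsProbabilityMeasure P] (h : IsBernoulliArray P ε) (r m c : ℕ) :
    P.real (quiet r m (c + (m + 1))) ≤
      P.real {x | (hits x 0 (m + 1)).card ≤ r} * P.real (survives r m c) +
        (1 - P.real {x | (hits x 0 (m + 1)).card ≤ r}) * P.real (quiet r m c) := by
  set A : Set (Cells n) := {x | (hits x 0 (m + 1)).card ≤ r}
  have hA : Determined (m + 1) A := determined_card_hits_le r 0 (m + 1)
  rw [← h.real_inter_shift_preimage hA (determined_survives r m c).measurableSet,
    ← probReal_compl_eq_one_sub hA.measurableSet,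
    ← h.real_inter_shift_preimage hA.compl (determined_quiet r m c).measurableSet]
  refine (measureReal_mono ?_).trans (measureReal_union_le _ _)
  intro x hx
  by_cases hxA : x ∈ A
  · exact Or.inl ⟨hxA, quiet_add_shift_mem_survives hx hxA⟩
  · exact Or.inr ⟨hxA, quiet_add_shift_mem_quiet hx⟩

/-- Last-exit decomposition: an upcrossing at `k` reads cells up to `k + m + 1`, the quiet event
after it only later ones, so each probability factors. Only an inequality is needed, so the union
bound suffices. -/
lemma one_le_real_quiet_add [IsProbabilityMeasure P] (h : IsBernoulliArray P ε) (r m X : ℕ) :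
    1 ≤ P.real (quiet r m X) +
      P.real (upcross r m 0) * ∑ k ∈ Finset.range X, P.real (quiet r m k) := by
  have huniv : (Set.univ : Set (Cells n)) ⊆ shift (m + 1) ⁻¹' quiet r m X ∪
      ⋃ k ∈ Finset.range X, upcross r m k ∩ shift (k + m + 2) ⁻¹' quiet r m (X - 1 - k) := by
    intro x _
    rcases quiet_or_exists_upcross r m X x with hx | ⟨k, hk, hx⟩
    · exact Or.inl hx
    · exact Or.inr (Set.mem_biUnion hk hx)
  have h1 := (measureReal_mono (μ := P) huniv).trans (measureReal_union_le _ _)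
  rw [probReal_univ, h.real_shift_preimage _ (determined_quiet r m X).measurableSet] at h1
  refine h1.trans ((add_le_add_iff_left _).2 ?_)
  refine (measureReal_biUnion_finset_le _ _).trans_eq ?_
  rw [← Finset.sum_range_reflect fun k => P.real (quiet (n := n) r m k), Finset.mul_sum]
  refine Finset.sum_congr rfl fun k _ => ?_
  rw [h.real_inter_shift_preimage (determined_upcross r m k)
    (determined_quiet r m _).measurableSet]
  congr 1
  rw [← h.real_shift_preimage k (determined_upcross r m 0).measurableSet]
  congr 1
  ext x
  rw [Set.mem_preimage, shift_mem_upcross, zero_add]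

/-- Sum the one-window recursion. Its first `m + 1` terms are at most `1` each, and the `1 - g` part
of the sum is absorbed on the left. -/
lemma mul_sum_real_quiet_le [IsProbabilityMeasure P] (h : IsBernoulliArray P ε) (r m X : ℕ) :
    P.real {x | (hits x 0 (m + 1)).card ≤ r} * ∑ k ∈ Finset.range X, P.real (quiet r m k) ≤
      (m + 1) + P.real {x | (hits x 0 (m + 1)).card ≤ r} *
        ∑ k ∈ Finset.range X, P.real (survives r m k) := by
  set g := P.real {x | (hits x 0 (m + 1)).card ≤ r}
  have h1 : ∑ k ∈ Finset.range X, P.real (quiet (n := n) r m k) ≤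
      ∑ k ∈ Finset.range (X + (m + 1)), P.real (quiet (n := n) r m k) :=
    Finset.sum_le_sum_of_subset_of_nonneg (Finset.range_mono (by omega))
      fun _ _ _ => measureReal_nonneg
  rw [add_comm X, Finset.sum_range_add] at h1
  have h2 : ∑ k ∈ Finset.range (m + 1), P.real (quiet (n := n) r m k) ≤ m + 1 := by
    refine (Finset.sum_le_sum fun k _ => measureReal_le_one).trans_eq ?_
    simp
  have h3 : ∑ k ∈ Finset.range X, P.real (quiet (n := n) r m (m + 1 + k)) ≤
      g * ∑ k ∈ Finset.range X, P.real (survives (n := n) r m k) +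
        (1 - g) * ∑ k ∈ Finset.range X, P.real (quiet (n := n) r m k) := by
    rw [Finset.mul_sum, Finset.mul_sum, ← Finset.sum_add_distrib]
    refine Finset.sum_le_sum fun k _ => ?_
    rw [add_comm (m + 1) k]
    exact h.real_quiet_add_le r m k
  linarith

/-- If the expected number of cells that a perfect system survives is at most `K`, then the mean
time between upcrossings is at most `K` plus the mean time needed to find a good window. -/
theorem one_le_real_upcross_mul [IsProbabilityMeasure P] (h : IsBernoulliArray P ε) (r m : ℕ)
    (hg : 0 < P.real {x | (hits x 0 (m + 1)).card ≤ r}) {K : ℝ}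
    (hK : ∀ X, ∑ k ∈ Finset.range X, P.real (survives r m k) ≤ K) :
    1 ≤ P.real (upcross r m 0) *
      ((m + 1) / P.real {x | (hits x 0 (m + 1)).card ≤ r} + K) := by
  set g := P.real {x | (hits x 0 (m + 1)).card ≤ r}
  have hb : ∀ X, ∑ k ∈ Finset.range X, P.real (quiet (n := n) r m k) ≤ (m + 1) / g + K := by
    intro X
    have h1 := h.mul_sum_real_quiet_le r m X
    rw [← mul_le_mul_iff_right₀ hg, mul_add, mul_div_cancel₀ _ hg.ne']
    nlinarith [hK X]
  have hs : Summable fun k => P.real (quiet (n := n) r m k) :=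
    summable_of_sum_range_le (fun _ => measureReal_nonneg) hb
  -- The partial sums are bounded, so `P (quiet X)` tends to `0` and drops out of the last-exit
  -- inequality.
  have hlim := hs.tendsto_atTop_zero.add_const
    (P.real (upcross (n := n) r m 0) * ((m + 1) / g + K))
  rw [zero_add] at hlim
  refine ge_of_tendsto' hlim fun X => (h.one_le_real_quiet_add r m X).trans ?_
  exact (add_le_add_iff_left _).2 (mul_le_mul_of_nonneg_left (hb X) measureReal_nonneg)

end IsBernoulliArray
-- From Poisson failures to cells.
/-- The failure pattern of the nodes in the time cells `(k * δ, (k + 1) * δ]`. -/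
noncomputable def cells {Ω : Type*} (N : Fin n → ℝ≥0 → Ω → ℕ) (δ : ℝ≥0) (ω : Ω) : Cells n :=
  fun k i => decide (N i (k * δ) ω < N i ((k + 1 : ℕ) * δ) ω)

lemma iIndepFun_map {Ω Ω' ι : Type*} {β : ι → Type*} [MeasurableSpace Ω] [MeasurableSpace Ω']
    [∀ i, MeasurableSpace (β i)] {μ : Measure Ω} {X : Ω → Ω'} (hX : Measurable X)
    {f : ∀ i, Ω' → β i} (hf : ∀ i, Measurable (f i)) (h : iIndepFun (fun i ω => f i (X ω)) μ) :
    iIndepFun f (μ.map X) := by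
  rw [iIndepFun_iff_measure_inter_preimage_eq_mul] at h ⊢
  intro S s hs
  rw [Measure.map_apply hX (Finset.measurableSet_biInter _ fun i hi => hf i (hs i hi)),
    Set.preimage_iInter₂]
  refine (h S hs).trans (Finset.prod_congr rfl fun i hi => ?_)
  rw [Measure.map_apply hX (hf i (hs i hi))]
  rfl

lemma lastRepair_gt {T : ℝ} (hT : 0 < T) (u : ℝ) (t : ℝ≥0) : (t : ℝ) - T < lastRepair T u t := by
  refine lt_of_lt_of_le ?_ (Real.le_coe_toNNReal _)
  have := Int.fract_lt_one (u + t / T)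
  have h2 : T * position T u t < T := by
    rw [position]
    nlinarith
  linarith

/-- Data loss at time `t` shows in the window of `m + 1` cells that ends with the cell of `t`. -/
lemma le_dataLossTime_of_cells_mem_survives {Ω : Type*} {N : Fin n → ℝ≥0 → Ω → ℕ} {T : ℝ} (hT : 0 < T) {r m : ℕ} {δ : ℝ≥0}
    (hδ : (m : ℝ) * δ = T) {ω : Ω} (hmono : ∀ i, Monotone fun t => N i t ω) {c : ℕ}
    (hc : cells N δ ω ∈ survives r m c) : (c : ℝ≥0∞) * δ ≤ dataLossTime N r T ω := by
  have hδ0 : 0 < (δ : ℝ) := by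
    by_contra! hle
    have : (δ : ℝ) = 0 := le_antisymm hle δ.coe_nonneg
    rw [this, mul_zero] at hδ
    exact hT.ne hδ
  refine le_iInf₂ fun t ⟨u, _, hu⟩ => ?_
  by_contra! hlt
  have hlt' : (t : ℝ) < c * δ := by
    have : t < (c : ℝ≥0) * δ := by exact_mod_cast hlt
    exact_mod_cast this
  set k := ⌊(t : ℝ) / δ⌋₊
  have hk1 : (k : ℝ) * δ ≤ t := by
    rw [← le_div_iff₀ hδ0]
    exact Nat.floor_le (by positivity)
  have hk2 : (t : ℝ) < (k + 1) * δ := by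
    rw [← div_lt_iff₀ hδ0]
    exact Nat.lt_floor_add_one _
  have hkc : k < c := by
    have : (k : ℝ) < c := lt_of_mul_lt_mul_right (hk1.trans_lt hlt') hδ0.le
    exact_mod_cast this
  refine absurd (hc k hkc) ?_
  rw [not_le]
  refine lt_of_lt_of_le hu (Finset.card_le_card fun i hi => ?_)
  rw [Finset.mem_filter] at hi
  by_contra hni
  -- A node with no hit in the window has a constant count across it, contradicting its failure
  -- since the last repair.
  have hstep : ∀ j, k - m ≤ j → j ≤ k + 1 → N i (j * δ) ω ≤ N i ((k - m : ℕ) * δ) ω := by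
    intro j hj
    induction j, hj using Nat.le_induction with
    | base => exact fun _ => le_rfl
    | succ j hj ih =>
      intro hjk
      refine le_trans ?_ (ih (by omega))
      by_contra! hlt
      exact hni (mem_hits.2 ⟨j, hj, by omega, by simpa [cells] using hlt⟩)
  have h1 : N i t ω ≤ N i ((k + 1 : ℕ) * δ) ω := by
    refine hmono i ?_
    rw [← NNReal.coe_le_coe]
    push_cast
    exact hk2.le
  have h2 : N i ((k - m : ℕ) * δ) ω ≤ N i (lastRepair T u t) ω := by
    refine hmono i ?_
    rw [← NNReal.coe_le_coe, NNReal.coe_mul, NNReal.coe_natCast]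
    -- The interval from `t - T` to `t` may meet `m + 1` cells. Truncated subtraction `k - m = 0`
    -- matches the truncation of `lastRepair` at time `0`.
    rcases le_total m k with hmk | hmk
    · have := lastRepair_gt hT u t
      rw [Nat.cast_sub hmk]
      nlinarith
    · rw [Nat.sub_eq_zero_of_le hmk]
      simp
  have := hstep (k + 1) (by omega) le_rfl
  omega

section

variable {Ω : Type*} [MeasurableSpace Ω] {μ : Measure Ω} {lam : ℝ≥0} {N : Fin n → ℝ≥0 → Ω → ℕ}

lemma IsFailureProcess.measurable_cells (hN : IsFailureProcess μ n lam N) (δ : ℝ≥0) :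
    Measurable (cells N δ) := by
  refine measurable_pi_lambda _ fun k => measurable_pi_lambda _ fun i => ?_
  exact (Measurable.of_discrete (f := fun p : ℕ × ℕ => decide (p.1 < p.2))).comp
    (((hN.poisson i).measurable _).prodMk ((hN.poisson i).measurable _))

lemma IsFailureProcess.isBernoulliArray_map_cells [IsProbabilityMeasure μ]
    (hN : IsFailureProcess μ n lam N) (δ : ℝ≥0) :
    IsBernoulliArray (μ.map (cells N δ)) (1 - Real.exp (-(lam * δ))) where
  rows := by
    refine iIndepFun_map (hN.measurable_cells δ)
      (fun i => measurable_pi_lambda _ fun k => measurable_entry k i) ?_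
    refine hN.indep.comp
      (fun _ (y : ℝ≥0 → ℕ) (k : ℕ) => decide (y (k * δ) < y ((k + 1 : ℕ) * δ))) fun i => ?_
    refine measurable_pi_lambda _ fun k => ?_
    have hpair : Measurable fun y : ℝ≥0 → ℕ => (y (k * δ), y ((k + 1 : ℕ) * δ)) := by fun_prop
    exact (Measurable.of_discrete (f := fun p : ℕ × ℕ => decide (p.1 < p.2))).comp hpair
  cols i := by
    refine iIndepFun_map (hN.measurable_cells δ) (fun k => measurable_entry k i) ?_
    have ht : Monotone fun k : ℕ => (k : ℝ≥0) * δ := fun a b hab => by dsimp only; gcongr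
    have := ((hN.poisson i).indep_increments.nat ht).comp (fun _ d => decide (0 < d))
      fun _ => Measurable.of_discrete
    convert this using 3 with k ω
    simp [cells, tsub_pos_iff_lt]
  prob k i := by
    have hle : (k : ℝ≥0) * δ ≤ (k + 1 : ℕ) * δ := by gcongr; omega
    have hlaw := (hN.poisson i).law_increments _ _ hle
    have hset : {x : Cells n | x k i = true} = (fun x : Cells n => x k i) ⁻¹' {true} := rfl
    rw [map_measureReal_apply (hN.measurable_cells δ)
      (hset ▸ measurable_entry k i (measurableSet_singleton true))]
    have hpre : cells N δ ⁻¹' {x | x k i = true} =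
        ((fun ω => N i ((k + 1 : ℕ) * δ) ω - N i (k * δ) ω) ⁻¹' {0})ᶜ := by
      ext ω
      simp [cells, Nat.sub_eq_zero_iff_le]
    have hm : Measurable fun ω => N i ((k + 1 : ℕ) * δ) ω - N i (k * δ) ω :=
      ((hN.poisson i).measurable _).sub ((hN.poisson i).measurable _)
    rw [hpre, probReal_compl_eq_one_sub (hm (measurableSet_singleton 0)),
      ← map_measureReal_apply hm (measurableSet_singleton 0), hlaw.map_eq,
      poissonMeasure_real_singleton]
    have hd : ((k + 1 : ℕ) : ℝ≥0) * δ - k * δ = δ := by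
      rw [Nat.cast_add, Nat.cast_one, add_mul, one_mul, add_tsub_cancel_left]
    rw [hd]
    simp

/-- Each further cell survived adds `δ` to the loss time, so `δ` times the number of survived cells
is a lower bound for it. The summand `1` pays for `c = 0`, where survival is vacuous. -/
lemma IsFailureProcess.sum_real_survives_le [IsProbabilityMeasure μ]
    (hN : IsFailureProcess μ n lam N) {T : ℝ} (hT : 0 < T) (r m : ℕ) {δ : ℝ≥0}
    (hδ : (m : ℝ) * δ = T) (hfin : MTTDL μ N r T ≠ ∞) (X : ℕ) :
    ∑ k ∈ Finset.range X, (μ.map (cells N δ)).real (survives r m k) ≤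
      1 + (MTTDL μ N r T).toReal / δ := by
  classical
  have hδ0 : 0 < (δ : ℝ) := by
    by_contra! hle
    have : (δ : ℝ) = 0 := le_antisymm hle δ.coe_nonneg
    rw [this, mul_zero] at hδ
    exact hT.ne hδ
  have hmeas : ∀ k, MeasurableSet (cells N δ ⁻¹' survives r m k) := fun k =>
    hN.measurable_cells δ (determined_survives r m k).measurableSet
  have := Measure.isProbabilityMeasure_map (μ := μ) (hN.measurable_cells δ).aemeasurable
  have hmono : ∀ᵐ ω ∂μ, ∀ i, Monotone fun t => N i t ω :=
    ae_all_iff.2 fun i => (hN.poisson i).mono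
  have hpt : ∀ᵐ ω ∂μ, ∑ k ∈ Finset.range X,
      (cells N δ ⁻¹' survives r m (k + 1)).indicator (fun _ => (δ : ℝ≥0∞)) ω ≤
        dataLossTime N r T ω := by
    filter_upwards [hmono] with ω hω
    simp only [Set.indicator_apply, Set.mem_preimage]
    rw [← Finset.sum_filter, Finset.sum_const, nsmul_eq_mul]
    set S := (Finset.range X).filter fun k => cells N δ ω ∈ survives r m (k + 1)
    rcases S.eq_empty_or_nonempty with h0 | hne
    · simp [h0]
    · have hmem := S.max'_mem hne
      have hsub : S ⊆ Finset.range (S.max' hne + 1) := fun k hk => by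
        have := S.le_max' k hk
        rw [Finset.mem_range]
        omega
      have hcard := Finset.card_le_card hsub
      rw [Finset.card_range] at hcard
      exact le_dataLossTime_of_cells_mem_survives hT hδ hω
        (survives_antitone r m hcard (Finset.mem_filter.1 hmem).2)
  have hint := lintegral_mono_ae hpt
  rw [lintegral_finsetSum _ fun k _ => measurable_const.indicator (hmeas _)] at hint
  simp only [lintegral_indicator_const (hmeas _)] at hint
  have hreal := ENNReal.toReal_mono hfin hint
  rw [ENNReal.toReal_sum fun k _ => ENNReal.mul_ne_top ENNReal.coe_ne_top (measure_ne_top _ _)]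
    at hreal
  have hterm : ∀ k, ((δ : ℝ≥0∞) * μ (cells N δ ⁻¹' survives r m (k + 1))).toReal =
      δ * (μ.map (cells N δ)).real (survives r m (k + 1)) := by
    intro k
    rw [map_measureReal_apply (hN.measurable_cells δ) (determined_survives r m _).measurableSet,
      ENNReal.toReal_mul, measureReal_def, ENNReal.coe_toReal]
  simp only [hterm] at hreal
  rw [← Finset.mul_sum] at hreal
  have h1 : ∑ k ∈ Finset.range X, (μ.map (cells N δ)).real (survives r m k) ≤
      ∑ k ∈ Finset.range (X + 1), (μ.map (cells N δ)).real (survives r m k) :=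
    Finset.sum_le_sum_of_subset_of_nonneg (Finset.range_mono (by omega))
      fun _ _ _ => measureReal_nonneg
  rw [Finset.sum_range_succ'] at h1
  have h2 : (μ.map (cells N δ)).real (survives r m 0) ≤ 1 := measureReal_le_one
  have h3 : ∑ k ∈ Finset.range X, (μ.map (cells N δ)).real (survives r m (k + 1)) ≤
      (MTTDL μ N r T).toReal / δ := by
    rw [le_div_iff₀ hδ0, mul_comm]
    exact hreal
  linarith

end

/-! ### Binomial weights and the bound at a fixed mesh. -/

lemma B_nonneg (n m : ℕ) {p : ℝ} (h0 : 0 ≤ p) (h1 : p ≤ 1) : 0 ≤ B n m p := by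
  have : 0 ≤ 1 - p := by linarith
  unfold B
  positivity

lemma sum_B (n : ℕ) (p : ℝ) : ∑ s ∈ Finset.range (n + 1), B n s p = 1 := by
  have h := add_pow (1 - p) p n
  rw [sub_add_cancel, one_pow] at h
  rw [h]
  refine Finset.sum_congr rfl fun s _ => ?_
  rw [B]
  ring

/-- The binomial weights sum to `1`, and the omitted weight `q(0)` is positive. -/
lemma qGt_lt_one (n : ℕ) {lam T : ℝ} (hlam : 0 ≤ lam) (hT : 0 ≤ T) (r : ℕ) :
    qGt n lam T r < 1 := by
  have hp1 : Real.exp (-(lam * T)) ≤ 1 := Real.exp_le_one_iff.2 (by nlinarith)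
  rw [← sum_B n (Real.exp (-(lam * T)))]
  refine Finset.sum_lt_sum_of_subset (i := 0) (fun s hs => ?_) (by simp) (by simp) ?_
    fun s _ _ => B_nonneg n s (Real.exp_pos _).le hp1
  · rw [Finset.mem_Ioc] at hs
    rw [Finset.mem_range]
    omega
  · rw [q, B, Nat.choose_zero_right, pow_zero]
    positivity

lemma continuous_qGt (n : ℕ) (lam : ℝ) (r : ℕ) : Continuous fun T => qGt n lam T r := by
  unfold qGt q B
  fun_prop

lemma q_pos {n r : ℕ} (hr : r ≤ n) {lam T : ℝ} (hlam : 0 < lam) (hT : 0 < T) :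
    0 < q n lam T r := by
  have hp1 : 0 < 1 - Real.exp (-(lam * T)) := by
    rw [sub_pos]
    exact Real.exp_lt_one_iff.2 (neg_neg_of_pos (mul_pos hlam hT))
  have := Nat.choose_pos hr
  unfold q B
  positivity

/-- The bound obtained with cells of length `T / m`. -/
lemma IsFailureProcess.one_le_mul_of_mesh {Ω : Type*} [MeasurableSpace Ω] {μ : Measure Ω}
    [IsProbabilityMeasure μ] {r : ℕ} (hr : r ≤ n) {lam : ℝ≥0} {N : Fin n → ℝ≥0 → Ω → ℕ}
    (hN : IsFailureProcess μ n lam N) {T : ℝ} (hT : 0 < T) (hfin : MTTDL μ N r T ≠ ∞)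
    {m : ℕ} {δ : ℝ} (hδ0 : 0 < δ) (hδ : (m : ℝ) * δ = T) :
    1 ≤ ((lam : ℝ) * ((n : ℝ) - r) * q n lam T r + (n : ℝ) ^ 2 * lam ^ 2 * δ) *
      ((T + δ) / (1 - qGt n lam (T + δ) r) + δ + (MTTDL μ N r T).toReal) := by
  lift δ to ℝ≥0 using hδ0.le
  have := Measure.isProbabilityMeasure_map (μ := μ) (hN.measurable_cells δ).aemeasurable
  have hP := hN.isBernoulliArray_map_cells δ
  set P := μ.map (cells N δ)
  set ε := 1 - Real.exp (-((lam : ℝ) * δ)) with hε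
  have hε0 : 0 ≤ ε := sub_nonneg.2 (Real.exp_le_one_iff.2 (by simp; positivity))
  have hε1 : ε ≤ lam * δ := by
    have := Real.add_one_le_exp (-((lam : ℝ) * δ))
    linarith
  have hpow : ∀ l : ℕ, (1 - ε) ^ l = Real.exp (-((lam : ℝ) * (l * δ))) := by
    intro l
    rw [hε, sub_sub_cancel, ← Real.exp_nat_mul]
    congr 1
    ring
  have hg : P.real {x | (hits x 0 (m + 1)).card ≤ r} = 1 - qGt n lam (T + δ) r := by
    have h1 := hP.real_card_hits_le 0 (m + 1) r
    rw [zero_add, hpow] at h1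
    rw [h1, ← hδ]
    simp only [qGt, q]
    push_cast
    rw [add_mul, one_mul]
  have hgpos : 0 < 1 - qGt n lam (T + δ) r :=
    sub_pos.2 (qGt_lt_one n lam.coe_nonneg (by positivity) r)
  have hu := hP.real_upcross_zero_le r m
  rw [hpow, hδ, ← q] at hu
  have hmain := hP.one_le_real_upcross_mul r m (hg ▸ hgpos)
    (hN.sum_real_survives_le hT r m hδ hfin)
  rw [hg] at hmain
  set E := (MTTDL μ N r T).toReal
  have hE : 0 ≤ E := ENNReal.toReal_nonneg
  have hq : 0 ≤ q n lam T r := B_nonneg n r (Real.exp_pos _).le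
    (Real.exp_le_one_iff.2 (by simp; positivity))
  have hnr : (0 : ℝ) ≤ n - r := sub_nonneg.2 (by exact_mod_cast hr)
  have hu' : P.real (upcross r m 0) ≤
      ((lam : ℝ) * ((n : ℝ) - r) * q n lam T r + (n : ℝ) ^ 2 * lam ^ 2 * δ) * δ := by
    refine hu.trans ?_
    have h1 : ((n : ℝ) - r) * q n lam T r * ε ≤ ((n : ℝ) - r) * q n lam T r * (lam * δ) := by
      gcongr
    have h2 : (n : ℝ) ^ 2 * ε ^ 2 ≤ (n : ℝ) ^ 2 * (lam * δ) ^ 2 := by gcongr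
    linarith
  refine hmain.trans ((mul_le_mul_of_nonneg_right hu' (by positivity)).trans_eq ?_)
  rw [mul_assoc]
  congr 1
  -- The factor `δ` left over from the upcrossing bound turns `(m + 1) / g + 1 + E / δ` into `(T +
  -- δ) / g + δ + E`.
  rw [← hδ] at hgpos ⊢
  field_simp
  ring

end LiquidSystem

/-! ### The limit of vanishing mesh. -/

theorem mainTheorem1 {Ω : Type*} [MeasurableSpace Ω] (μ : Measure Ω) [IsProbabilityMeasure μ]
    (n r : ℕ) (hr : r < n) (lam : ℝ≥0) (hlam : 0 < lam) (T : ℝ) (hT : 0 < T)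
    (N : Fin n → ℝ≥0 → Ω → ℕ) (hN : LiquidSystem.IsFailureProcess μ n lam N) :
    ENNReal.ofReal
        (1 / ((lam : ℝ) * ((n : ℝ) - (r : ℝ)) * LiquidSystem.q n lam T r)
          - T / (1 - LiquidSystem.qGt n lam T r))
      ≤ LiquidSystem.MTTDL μ N r T := by
  by_cases hfin : LiquidSystem.MTTDL μ N r T = ∞
  · rw [hfin]
    exact le_top
  set E := (LiquidSystem.MTTDL μ N r T).toReal with hE
  have hlam' : (0 : ℝ) < lam := hlam
  set a := (lam : ℝ) * ((n : ℝ) - (r : ℝ)) * LiquidSystem.q n lam T r with ha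
  have hnr : (0 : ℝ) < n - r := sub_pos.2 (by exact_mod_cast hr)
  have ha0 : 0 < a := mul_pos (mul_pos hlam' hnr) (LiquidSystem.q_pos hr.le hlam' hT)
  have hq1 := LiquidSystem.qGt_lt_one n hlam'.le hT.le r
  set F : ℝ → ℝ := fun δ => (a + (n : ℝ) ^ 2 * lam ^ 2 * δ) *
    ((T + δ) / (1 - LiquidSystem.qGt n lam (T + δ) r) + δ + E) with hF
  have hcont : ContinuousAt F 0 := by
    have hc : Continuous fun δ : ℝ => LiquidSystem.qGt n lam (T + δ) r :=
      (LiquidSystem.continuous_qGt n lam r).comp (continuous_const.add continuous_id)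
    refine ContinuousAt.mul (by fun_prop) ?_
    refine ((ContinuousAt.div (by fun_prop) (continuous_const.sub hc).continuousAt ?_).add
      continuousAt_id).add continuousAt_const
    simp only [Pi.sub_apply, add_zero]
    linarith
  -- Meshes `T / (j + 1)` divide `T` exactly; at `δ = 0` both the double-failure term and the extra
  -- cell disappear.
  have hlim : Filter.Tendsto (fun j : ℕ => F (T / ((j + 1 : ℕ) : ℝ))) Filter.atTop (nhds (F 0)) :=
    hcont.tendsto.comp
      ((tendsto_const_div_atTop_nhds_zero_nat T).comp (Filter.tendsto_add_atTop_nat 1))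
  have h1 : 1 ≤ F 0 := ge_of_tendsto' hlim fun j =>
    hN.one_le_mul_of_mesh hr.le hT hfin (m := j + 1) (by positivity) (by field_simp)
  simp only [hF, mul_zero, add_zero] at h1
  rw [← ENNReal.ofReal_toReal hfin]
  refine ENNReal.ofReal_le_ofReal ?_
  rw [sub_le_iff_le_add, div_le_iff₀ ha0]
  linarith
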